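/- For $a>0$ let $\mathfrak D(a)=\{t\in\mathbb C:\operatorname{dist}(t,(0,+\infty))<a\}$. For $a>0$, $R\ge 0$ let $H(a,R)$ be the space of all functions $F$ that are analytic in $\mathfrak D(a)$ and of exponential growth of type at most $R$ there, i.e. for all $0<A<a$ and $r>R$ there is a constant $C$ with $|F(t)|\le Ce^{r|t|}$ for $t\in\mathfrak D(A)$. Let $$\mathcal L\{F\}(\zeta)=\zeta\int_0^{+\infty}e^{-\zeta t}F(t)\,dt\qquad(\operatorname{Re}\zeta>R),$$ and put $S(a,R)=\mathcal L H(a,R)$, $H=\bigcup_{a>0,R\ge0}H(a,R)$, $S=\mathcal L H=\bigcup_{a>0,R\ge0}S(a,R)$, where functions that differ only by restriction to a smaller region $\mathfrak D(a')$, respectively to a smaller right half-plane, are identified. For $\operatorname{Re}\alpha>-1$ and $F\in H$ let $\mathcal L_\alpha\{F\}(\zeta)=\zeta^{\alpha}\mathcal L\{t^{\alpha}F(t)\}(\zeta)$ (principal powers), and $$\mathcal D_\alpha=\mathcal L^{-1}\mathcal L_\alpha,\quad \mathcal I_\alpha=\mathcal L_\alpha^{-1}\mathcal L,\quad \hat{\mathcal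 D}_\alpha=\mathcal L_\alpha\mathcal L^{-1},\quad \hat{\mathcal I}_\alpha=\mathcal L\mathcal L_\alpha^{-1}.$$ **Theorem 2.** Let $\operatorname{Re}\alpha>-1$. Then $\mathcal L$ and $\mathcal L_\alpha$ map $H$ bijectively onto $S$, so that these four operators are well defined, the first two on $H$ and the last two on $S$. For all $a>0$, $R\ge0$: (i) $\mathcal D_\alpha F,\ \mathcal I_\alpha F\in H(a,R)$ for every $F\in H(a,R)$; (ii) $\mathcal D_\alpha$ and $\mathcal I_\alpha$ map $H(a,R)$ bijectively onto $H(a,R)$, and $\hat{\mathcal D}_\alpha$ and $\hat{\mathcal I}_\alpha$ map $S(a,R)$ bijectively onto $S(a,R)$. Moreover $\mathcal D_\alpha$ and $\mathcal I_\alpha$ map $H$ bijectively onto $H$, and $\hat{\mathcal D}_\alpha$ and $\hat{\mathcal I}_\alpha$ map $S$ bijectively onto $S$. -/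

import Mathlib

open Set Filter

noncomputable section

namespace LaplaceBorel

/-- The open half-line `(0, +∞)`, as a subset of `ℂ`. -/
def ray : Set ℂ := Complex.ofReal '' Ioi (0 : ℝ)

/-- The region `𝔇(a) = {t ∈ ℂ : dist (t, (0, +∞)) < a}`. -/
def region (a : ℝ) : Set ℂ := Metric.thickening a ray

/-- `F` is analytic in `𝔇(a)` and has exponential growth of type (at most) `R` at infinity there:
for all `0 < A < a` and all `r > R` it is `O(exp (r |t|))` on `𝔇(A)`. -/
structure IsHFun (a R : ℝ) (F : ℂ → ℂ) : Prop where
  analytic : AnalyticOnNhd ℂ F (region a)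
  growth : ∀ A : ℝ, 0 < A → A < a → ∀ r : ℝ, R < r →
    ∃ C : ℝ, ∀ t ∈ region A, ‖F t‖ ≤ C * Real.exp (r * ‖t‖)

/-- The filter generated by the regions `𝔇(a)`, `a > 0`. Functions that are analytic in some
`𝔇(a)` are identified when they agree on some (smaller) region of this kind; on analytic
functions in a fixed `𝔇(a)`, which is connected, no two distinct functions are identified. -/
def regionFilter : Filter ℂ := ⨅ a ∈ Ioi (0 : ℝ), 𝓟 (region a)

/-- The filter generated by the half-planes `Re ζ > r`. Functions on right half-planes are
identified when they agree on some (smaller) right half-plane; on analytic functions in a fixed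
half-plane no two distinct functions are identified. -/
def halfPlaneFilter : Filter ℂ := comap Complex.re atTop

/-- Functions defined on some `𝔇(a)`, up to restriction. -/
abbrev TFun : Type := Germ regionFilter ℂ

/-- Functions defined on some right half-plane, up to restriction. -/
abbrev ZFun : Type := Germ halfPlaneFilter ℂ

/-- The space `H(a, R)`. -/
def Hspace (a R : ℝ) : Set TFun := {φ | ∃ F : ℂ → ℂ, IsHFun a R F ∧ φ = (F : TFun)}

/-- The space `H`, the union of all `H(a, R)` with `a > 0` and `R ≥ 0`. -/
def Hunion : Set TFun := {φ | ∃ a R : ℝ, 0 < a ∧ 0 ≤ R ∧ φ ∈ Hspace a R}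

/-- `ζ ∫₀^∞ exp (-ζ t) f(t) dt`. -/
def laplaceIntegral (f : ℝ → ℂ) (ζ : ℂ) : ℂ :=
  ζ * ∫ t in Ioi (0 : ℝ), Complex.exp (-ζ * (t : ℂ)) * f t

theorem laplaceIntegral_congr {f g : ℝ → ℂ} (h : ∀ t : ℝ, 0 < t → f t = g t) :
    laplaceIntegral f = laplaceIntegral g := by
  funext ζ
  unfold laplaceIntegral
  congr 1
  refine MeasureTheory.setIntegral_congr_fun measurableSet_Ioi fun t ht => ?_
  simp only [h t ht]

theorem eq_on_ray {F G : ℂ → ℂ} (h : F =ᶠ[regionFilter] G) (t : ℝ) (ht : 0 < t) :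
    F t = G t := by
  have hle : 𝓟 ray ≤ regionFilter :=
    le_iInf₂ fun a ha => principal_mono.2 (Metric.self_subset_thickening ha ray)
  exact eventually_principal.1 (h.filter_mono hle) t ⟨t, ht, rfl⟩

/-- The Laplace transform `𝓛`: `𝓛{F}(ζ) = ζ ∫₀^∞ exp (-ζ t) F(t) dt`. -/
def laplace (φ : TFun) : ZFun :=
  φ.liftOn (fun F => ((laplaceIntegral fun t => F t : ℂ → ℂ) : ZFun)) fun _ _ h =>
    congrArg _ (laplaceIntegral_congr fun t ht => eq_on_ray h t ht)

/-- The operator `𝓛_α`: `𝓛_α{F}(ζ) = ζ ^ α 𝓛{t ^ α F(t)}(ζ)` (principal powers). -/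
def laplaceα (α : ℂ) (φ : TFun) : ZFun :=
  φ.liftOn
    (fun F => ((fun ζ => ζ ^ α * laplaceIntegral (fun t => (t : ℂ) ^ α * F t) ζ : ℂ → ℂ) : ZFun))
    fun _ _ h => by
      simp only
      rw [laplaceIntegral_congr fun t ht => congrArg ((t : ℂ) ^ α * ·) (eq_on_ray h t ht)]

/-- The space `S(a, R) = 𝓛 H(a, R)`. -/
def Sspace (a R : ℝ) : Set ZFun := laplace '' Hspace a R

/-- The space `S = 𝓛 H`. -/
def Sunion : Set ZFun := laplace '' Hunion

/-- The inverse `𝓛⁻¹` of `𝓛` on `H`. -/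
def laplaceInv : ZFun → TFun := Function.invFunOn laplace Hunion

/-- The inverse `𝓛_α⁻¹` of `𝓛_α` on `H`. -/
def laplaceαInv (α : ℂ) : ZFun → TFun := Function.invFunOn (laplaceα α) Hunion

/-- Fractional differentiation `𝓓_α = 𝓛⁻¹ 𝓛_α`. -/
def fracD (α : ℂ) (φ : TFun) : TFun := laplaceInv (laplaceα α φ)

/-- Fractional integration `𝓘_α = 𝓛_α⁻¹ 𝓛`. -/
def fracI (α : ℂ) (φ : TFun) : TFun := laplaceαInv α (laplace φ)

/-- The dual fractional differentiation `𝓛_α 𝓛⁻¹`. -/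
def dualD (α : ℂ) (P : ZFun) : ZFun := laplaceα α (laplaceInv P)

/-- The dual fractional integration `𝓛 𝓛_α⁻¹`. -/
def dualI (α : ℂ) (P : ZFun) : ZFun := laplace (laplaceαInv α P)

end LaplaceBorel

end

/-!
For `β` and `γ` with real part `> -1`, the images of `H(a, R)` under `𝓛_β` and `𝓛_γ` coincide, and
each `𝓛_α` is injective on `H`. Since `𝓛 = 𝓛_0`, both `𝓛` and `𝓛_α` are then bijections of `H(a, R)`
onto `S(a, R)` for all `a` and `R`, and every statement about the four operators is a composition
of such bijections and their inverses.

The images coincide for two reasons.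

* If `Re β < Re γ`, then `𝓛_β F = 𝓛_γ G` with
  `G(t) = Γ(γ - β)⁻¹ ∫₀¹ x ^ β (1 - x) ^ (γ - β - 1) F(t x) dx`:
  for `t > 0`, `t ^ γ G(t)` is the fractional integral of order `γ - β` of `t ^ β F(t)`, and
  the Laplace transform turns convolution into multiplication (`integral_cpow_mul_betaMean`). As
  `𝔇(a)` is star-shaped about `0` and `R ≥ 0`, the average `G` is again in `H(a, R)`
  (`IsHFun.betaMean`).
* Integration by parts gives `𝓛_{α + 1} F = 𝓛_α (t F' + (α + 1) F)`
  (`mul_integral_cpow_add_one`), and the Cauchy estimate keeps `t F' + (α + 1) F` in `H(a, R)`.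

So the image under `𝓛_β` lies in the image under `𝓛_{γ + n}` for a large integer `n`, hence in the
image under `𝓛_γ` (`image_laplaceα_subset`).

Injectivity (`injOn_laplaceα`) is Fourier inversion on a vertical line, which determines `F` on the
half-line, followed by the identity theorem on the convex set `𝔇(a)`.
-/

namespace LaplaceBorel

open MeasureTheory Topology

/-! ### The regions `𝔇(a)` -/

theorem isOpen_region (a : ℝ) : IsOpen (region a) := Metric.isOpen_thickening

theorem region_mono {a b : ℝ} (h : a ≤ b) : region a ⊆ region b := Metric.thickening_mono h ray

theorem convex_region (a : ℝ) : Convex ℝ (region a) := by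
  refine Convex.thickening ?_ a
  exact (convex_Ioi (0 : ℝ)).linear_image Complex.ofRealCLM.toLinearMap

theorem zero_mem_region {a : ℝ} (ha : 0 < a) : (0 : ℂ) ∈ region a := by
  refine Metric.mem_thickening_iff.2 ⟨((a / 2 : ℝ) : ℂ), ⟨a / 2, half_pos ha, rfl⟩, ?_⟩
  rw [dist_zero_left, Complex.norm_real, Real.norm_of_nonneg (half_pos ha).le]
  exact half_lt_self ha

theorem ofReal_mem_region {a : ℝ} (ha : 0 < a) {t : ℝ} (ht : 0 ≤ t) : (t : ℂ) ∈ region a := by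
  rcases ht.eq_or_lt with rfl | ht
  · exact zero_mem_region ha
  · exact Metric.self_subset_thickening ha ray ⟨t, ht, rfl⟩

theorem mul_ofReal_mem_region {a : ℝ} (ha : 0 < a) {t : ℂ} (ht : t ∈ region a) {x : ℝ}
    (hx : x ∈ Icc (0 : ℝ) 1) : t * x ∈ region a := by
  have := (convex_region a).smul_mem_of_zero_mem (zero_mem_region ha) ht hx
  rwa [Complex.real_smul, mul_comm] at this

theorem closedBall_subset_region {A d b : ℝ} (hd : A + d ≤ b) {t : ℂ} (ht : t ∈ region A) :
    Metric.closedBall t d ⊆ region b := by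
  obtain ⟨z, hz, htz⟩ := Metric.mem_thickening_iff.1 ht
  intro s hs
  refine Metric.mem_thickening_iff.2 ⟨z, hz, ?_⟩
  have := dist_triangle s t z
  have := Metric.mem_closedBall.1 hs
  linarith

theorem exists_mem_region {a : ℝ} (ha : 0 < a) {t : ℂ} (ht : t ∈ region a) :
    ∃ A, 0 < A ∧ A < a ∧ t ∈ region A := by
  obtain ⟨z, hz, htz⟩ := Metric.mem_thickening_iff.1 ht
  obtain ⟨A, hA, hAa⟩ := exists_between (max_lt ha htz)
  exact ⟨A, (le_max_left _ _).trans_lt hA, hAa,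
    Metric.mem_thickening_iff.2 ⟨z, hz, (le_max_right _ _).trans_lt hA⟩⟩

/-! ### Operations on functions of exponential type -/

section IsHFun

variable {a R : ℝ} {F G : ℂ → ℂ}

theorem IsHFun.exists_nonneg_bound (hF : IsHFun a R F) {A : ℝ} (hA : 0 < A) (hAa : A < a) {r : ℝ}
    (hr : R < r) : ∃ C, 0 ≤ C ∧ ∀ t ∈ region A, ‖F t‖ ≤ C * Real.exp (r * ‖t‖) := by
  obtain ⟨C, hC⟩ := hF.growth A hA hAa r hr
  exact ⟨max C 0, le_max_right _ _, fun t ht => (hC t ht).trans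
    (mul_le_mul_of_nonneg_right (le_max_left _ _) (Real.exp_pos _).le)⟩

theorem IsHFun.mono (hF : IsHFun a R F) {a' R' : ℝ} (ha : a' ≤ a) (hR : R ≤ R') :
    IsHFun a' R' F :=
  ⟨hF.analytic.mono (region_mono ha), fun A hA hAa r hr =>
    hF.growth A hA (hAa.trans_le ha) r (hR.trans_lt hr)⟩

theorem IsHFun.add (hF : IsHFun a R F) (hG : IsHFun a R G) :
    IsHFun a R (fun t => F t + G t) := by
  refine ⟨fun t ht => (hF.analytic t ht).add (hG.analytic t ht), fun A hA hAa r hr => ?_⟩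
  obtain ⟨C, hC⟩ := hF.growth A hA hAa r hr
  obtain ⟨D, hD⟩ := hG.growth A hA hAa r hr
  refine ⟨C + D, fun t ht => ?_⟩
  rw [add_mul]
  exact norm_add_le_of_le (hC t ht) (hD t ht)

theorem IsHFun.const_mul (hF : IsHFun a R F) (c : ℂ) : IsHFun a R (fun t => c * F t) := by
  refine ⟨fun t ht => analyticAt_const.mul (hF.analytic t ht), fun A hA hAa r hr => ?_⟩
  obtain ⟨C, hC⟩ := hF.growth A hA hAa r hr
  refine ⟨‖c‖ * C, fun t ht => ?_⟩
  rw [norm_mul, mul_assoc]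
  exact mul_le_mul_of_nonneg_left (hC t ht) (norm_nonneg c)

theorem IsHFun.sub (hF : IsHFun a R F) (hG : IsHFun a R G) :
    IsHFun a R (fun t => F t - G t) := by
  simpa [sub_eq_add_neg] using hF.add (hG.const_mul (-1))

/-- The factor `t` costs no type, since every `r > R` is allowed: `|t|` is absorbed by
`exp ((r - r') |t|)` with `R < r' < r`. -/
theorem IsHFun.id_mul (hF : IsHFun a R F) : IsHFun a R (fun t => t * F t) := by
  refine ⟨fun t ht => analyticAt_id.mul (hF.analytic t ht), fun A hA hAa r hr => ?_⟩
  obtain ⟨r', hr', hrr⟩ := exists_between hr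
  obtain ⟨C, hC0, hC⟩ := hF.exists_nonneg_bound hA hAa hr'
  have hd : 0 < r - r' := sub_pos.2 hrr
  refine ⟨(r - r')⁻¹ * C, fun t ht => ?_⟩
  have h1 : ‖t‖ ≤ (r - r')⁻¹ * Real.exp ((r - r') * ‖t‖) := by
    rw [le_inv_mul_iff₀ hd]
    linarith [Real.add_one_le_exp ((r - r') * ‖t‖)]
  calc ‖t * F t‖ = ‖t‖ * ‖F t‖ := norm_mul _ _
    _ ≤ ((r - r')⁻¹ * Real.exp ((r - r') * ‖t‖)) * (C * Real.exp (r' * ‖t‖)) :=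
        mul_le_mul h1 (hC t ht) (norm_nonneg _) (by positivity)
    _ = (r - r')⁻¹ * C * (Real.exp ((r - r') * ‖t‖) * Real.exp (r' * ‖t‖)) := by ring
    _ = (r - r')⁻¹ * C * Real.exp (r * ‖t‖) := by
        rw [← Real.exp_add]; congr 2; ring

/-- By the Cauchy estimate on discs of a fixed radius, `H(a, R)` is closed under differentiation. -/
theorem IsHFun.deriv (hR : 0 ≤ R) (hF : IsHFun a R F) : IsHFun a R (deriv F) := by
  refine ⟨hF.analytic.deriv, fun A hA hAa r hr => ?_⟩
  obtain ⟨b, hAb, hba⟩ := exists_between hAa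
  obtain ⟨C, hC0, hC⟩ := hF.exists_nonneg_bound (hA.trans hAb) hba hr
  have hd : 0 < b - A := sub_pos.2 hAb
  refine ⟨C * Real.exp (r * (b - A)) / (b - A), fun t ht => ?_⟩
  have hsub : Metric.closedBall t (b - A) ⊆ region b :=
    closedBall_subset_region (by linarith) ht
  have hdiff : DiffContOnCl ℂ F (Metric.ball t (b - A)) :=
    DifferentiableOn.diffContOnCl_ball (U := region b)
      (fun z hz => (hF.analytic z (region_mono hba.le hz)).differentiableAt.differentiableWithinAt)
      hsub
  have hr0 : 0 ≤ r := hR.trans hr.le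
  have := Complex.norm_deriv_le_of_forall_mem_sphere_norm_le hd hdiff
    (C := C * Real.exp (r * (b - A)) * Real.exp (r * ‖t‖)) fun z hz => by
      refine (hC z (hsub (Metric.sphere_subset_closedBall hz))).trans ?_
      rw [mul_assoc, ← Real.exp_add]
      have h1 : ‖z‖ ≤ (b - A) + ‖t‖ := by
        have := norm_le_norm_sub_add z t
        rwa [mem_sphere_iff_norm.1 hz] at this
      refine mul_le_mul_of_nonneg_left (Real.exp_le_exp.2 ?_) hC0
      rw [← mul_add]
      exact mul_le_mul_of_nonneg_left h1 hr0
  rwa [mul_div_right_comm] at this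

end IsHFun

/-! ### Laplace integrals with a power weight -/

section Laplace

variable {a R : ℝ} {F : ℂ → ℂ}

theorem continuousOn_laplace_integrand (ha : 0 < a) (hF : IsHFun a R F) (α ζ : ℂ) :
    ContinuousOn (fun t : ℝ => Complex.exp (-ζ * t) * ((t : ℂ) ^ α * F t)) (Ioi 0) := by
  intro t ht
  have h1 : ContinuousAt (fun t : ℝ => (t : ℂ) ^ α) t :=
    Complex.continuousAt_ofReal_cpow_const t α (Or.inr (ne_of_gt ht))
  have h2 : ContinuousAt (fun t : ℝ => F t) t :=
    ContinuousAt.comp (f := fun t : ℝ => (t : ℂ))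
      (hF.analytic t (ofReal_mem_region ha (le_of_lt ht))).continuousAt
      Complex.continuous_ofReal.continuousAt
  have h3 : ContinuousAt (fun t : ℝ => Complex.exp (-ζ * t)) t := by fun_prop
  exact (h3.mul (h1.mul h2)).continuousWithinAt

/-- A bound for the Laplace integrand that is uniform in the half-plane `Re ζ ≥ σ`. -/
theorem exists_integrable_bound (ha : 0 < a) (hF : IsHFun a R F) {α : ℂ}
    (hα : -1 < α.re) {σ : ℝ} (hσ : R < σ) :
    ∃ g : ℝ → ℝ, IntegrableOn g (Ioi 0) ∧ ∀ ζ : ℂ, σ ≤ ζ.re → ∀ t ∈ Ioi (0 : ℝ),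
      ‖Complex.exp (-ζ * t) * ((t : ℂ) ^ α * F t)‖ ≤ g t := by
  obtain ⟨r, hr, hrσ⟩ := exists_between hσ
  obtain ⟨C, hC0, hC⟩ := hF.exists_nonneg_bound (half_pos ha) (half_lt_self ha) hr
  refine ⟨fun t => C * (t ^ α.re * Real.exp (-(σ - r) * t ^ (1 : ℝ))),
    (integrableOn_rpow_mul_exp_neg_mul_rpow hα one_pos (sub_pos.2 hrσ)).const_mul C,
    fun ζ hζ t ht => ?_⟩
  have ht0 : 0 < t := ht
  have h1 := hC t (ofReal_mem_region (half_pos ha) ht0.le)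
  rw [Complex.norm_real, Real.norm_of_nonneg ht0.le] at h1
  rw [norm_mul, norm_mul, Complex.norm_cpow_eq_rpow_re_of_pos ht0, Complex.norm_exp]
  simp only [Real.rpow_one]
  have h2 : (-ζ * t).re = -ζ.re * t := by simp
  rw [h2]
  calc Real.exp (-ζ.re * t) * (t ^ α.re * ‖F t‖)
      ≤ Real.exp (-σ * t) * (t ^ α.re * (C * Real.exp (r * t))) := by
        gcongr
    _ = C * (t ^ α.re * (Real.exp (-σ * t) * Real.exp (r * t))) := by ring
    _ = C * (t ^ α.re * Real.exp (-(σ - r) * t)) := by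
        rw [← Real.exp_add]; congr 3; ring

theorem integrableOn_laplace_integrand (ha : 0 < a) (hF : IsHFun a R F) {α ζ : ℂ}
    (hα : -1 < α.re) (hζ : R < ζ.re) :
    IntegrableOn (fun t : ℝ => Complex.exp (-ζ * t) * ((t : ℂ) ^ α * F t)) (Ioi 0) := by
  obtain ⟨g, hg, hb⟩ := exists_integrable_bound ha hF hα hζ
  refine Integrable.mono' hg
    ((continuousOn_laplace_integrand ha hF α ζ).aestronglyMeasurable measurableSet_Ioi) ?_
  exact (ae_restrict_iff' measurableSet_Ioi).2 (ae_of_all _ fun t ht => hb ζ le_rfl t ht)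

theorem isOpen_halfPlane (R : ℝ) : IsOpen {ζ : ℂ | R < ζ.re} :=
  isOpen_lt continuous_const Complex.continuous_re

theorem differentiableOn_laplace (ha : 0 < a) (hF : IsHFun a R F) {α : ℂ} (hα : -1 < α.re) :
    DifferentiableOn ℂ
      (fun ζ : ℂ => ∫ t in Ioi (0 : ℝ), Complex.exp (-ζ * t) * ((t : ℂ) ^ α * F t))
      {ζ : ℂ | R < ζ.re} := by
  intro ζ₀ hζ₀
  obtain ⟨σ, hRσ, hσ⟩ := exists_between (show R < ζ₀.re from hζ₀)
  obtain ⟨g, hg, hb⟩ := exists_integrable_bound ha hF.id_mul hα hRσ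
  have := hasDerivAt_integral_of_dominated_loc_of_deriv_le (μ := volume.restrict (Ioi (0 : ℝ)))
    (F := fun (ζ : ℂ) (t : ℝ) => Complex.exp (-ζ * t) * ((t : ℂ) ^ α * F t))
    (F' := fun (ζ : ℂ) (t : ℝ) => -(Complex.exp (-ζ * t) * ((t : ℂ) ^ α * (t * F t))))
    (bound := g) ((isOpen_halfPlane σ).mem_nhds hσ)
    (Eventually.of_forall fun ζ =>
      (continuousOn_laplace_integrand ha hF α ζ).aestronglyMeasurable measurableSet_Ioi)
    (integrableOn_laplace_integrand ha hF hα hζ₀)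
    ((continuousOn_laplace_integrand ha hF.id_mul α ζ₀).neg.aestronglyMeasurable
      measurableSet_Ioi)
    ((ae_restrict_iff' measurableSet_Ioi).2 (ae_of_all _ fun t ht ζ hζ => by
      rw [norm_neg]; exact hb ζ (le_of_lt hζ) t ht)) hg
    (ae_of_all _ fun t ζ _ => by
      have h1 : HasDerivAt (fun ζ : ℂ => -ζ * (t : ℂ)) (-1 * t) ζ :=
        (hasDerivAt_id ζ).neg.mul_const _
      convert! h1.cexp.mul_const ((t : ℂ) ^ α * F t) using 1
      ring)
  exact this.2.differentiableAt.differentiableWithinAt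

/-- Integration by parts; the boundary term at `0` vanishes because `Re (α + 1) > 0`. -/
theorem mul_integral_cpow_add_one (ha : 0 < a) (hR : 0 ≤ R) (hF : IsHFun a R F) {α ζ : ℂ}
    (hα : -1 < α.re) (hζ : R < ζ.re) :
    ζ * ∫ t in Ioi (0 : ℝ), Complex.exp (-ζ * t) * ((t : ℂ) ^ (α + 1) * F t) =
      ∫ t in Ioi (0 : ℝ),
        Complex.exp (-ζ * t) * ((t : ℂ) ^ α * ((α + 1) * F t + t * deriv F t)) := by
  have hα1 : 0 < (α + 1).re := by rw [Complex.add_re, Complex.one_re]; linarith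
  have hα0 : α + 1 ≠ 0 := fun h => by simp [h] at hα1
  have hI := integrableOn_laplace_integrand ha hF (α := α + 1) (by linarith) hζ
  have hT : IsHFun a R (fun t => (α + 1) * F t + t * deriv F t) :=
    (hF.const_mul _).add (hF.deriv hR).id_mul
  have hJ := integrableOn_laplace_integrand ha hT hα hζ
  set u : ℝ → ℂ := fun t => Complex.exp (-ζ * t) * ((t : ℂ) ^ (α + 1) * F t) with hu
  set v : ℝ → ℂ := fun t =>
    Complex.exp (-ζ * t) * ((t : ℂ) ^ α * ((α + 1) * F t + t * deriv F t)) with hv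
  have hderiv : ∀ t ∈ Ioi (0 : ℝ), HasDerivAt u (v t - ζ * u t) t := by
    intro t ht
    have ht0 : (t : ℂ) ≠ 0 := Complex.ofReal_ne_zero.2 (ne_of_gt ht)
    have h1 : HasDerivAt (fun z : ℂ => Complex.exp (-ζ * z)) (Complex.exp (-ζ * t) * (-ζ * 1)) t :=
      ((hasDerivAt_id (t : ℂ)).const_mul (-ζ)).cexp
    have h2 : HasDerivAt (fun z : ℂ => z ^ (α + 1)) ((α + 1) * (t : ℂ) ^ α * 1) t := by
      simpa using (hasDerivAt_id (t : ℂ)).cpow_const (c := α + 1) (Or.inl ht)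
    have h3 : HasDerivAt F (_root_.deriv F t) t :=
      (hF.analytic t (ofReal_mem_region ha (le_of_lt ht))).differentiableAt.hasDerivAt
    convert! (h1.mul (h2.mul h3)).comp_ofReal using 1
    simp only [hu, hv, Pi.mul_apply, Complex.cpow_add _ _ ht0, Complex.cpow_one]
    ring
  have hcont : ContinuousWithinAt u (Ici 0) 0 := by
    have h1 : ContinuousAt (fun t : ℝ => (t : ℂ) ^ (α + 1)) 0 :=
      Complex.continuousAt_ofReal_cpow_const 0 _ (Or.inl hα1)
    have h2 : ContinuousAt (fun t : ℝ => F t) 0 :=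
      ContinuousAt.comp (f := fun t : ℝ => (t : ℂ))
        (hF.analytic _ (ofReal_mem_region ha le_rfl)).continuousAt
        Complex.continuous_ofReal.continuousAt
    have h3 : ContinuousAt (fun t : ℝ => Complex.exp (-ζ * t)) 0 := by fun_prop
    exact (h3.mul (h1.mul h2)).continuousWithinAt
  have hint : IntegrableOn (fun t => v t - ζ * u t) (Ioi 0) := hJ.sub (hI.const_mul ζ)
  have key := integral_Ioi_of_hasDerivAt_of_tendsto hcont hderiv hint
    (tendsto_zero_of_hasDerivAt_of_integrableOn_Ioi hderiv hint hI)
  have hu0 : u 0 = 0 := by simp [hu, Complex.zero_cpow hα0]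
  rw [hu0, sub_zero, integral_sub hJ (hI.const_mul ζ), integral_const_mul] at key
  exact (sub_eq_zero.1 key).symm

theorem isHFun_one : IsHFun a 0 (fun _ => 1) :=
  ⟨fun _ _ => analyticAt_const, fun A _ _ r hr => ⟨1, fun t _ => by
    rw [norm_one, one_mul]; exact Real.one_le_exp (by positivity)⟩⟩

/-- The Laplace transform of a power. For real `ζ` this is Euler's integral; both sides are
analytic in `Re ζ > 0`. -/
theorem integral_exp_mul_cpow {q ζ : ℂ} (hq : 0 < q.re) (hζ : 0 < ζ.re) :
    ∫ t in Ioi (0 : ℝ), Complex.exp (-ζ * t) * (t : ℂ) ^ (q - 1) =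
      ζ ^ (-q) * Complex.Gamma q := by
  have hq1 : -1 < (q - 1).re := by rw [Complex.sub_re, Complex.one_re]; linarith
  have h1 := (differentiableOn_laplace one_pos isHFun_one hq1).analyticOnNhd (isOpen_halfPlane 0)
  simp only [mul_one] at h1
  have h2 : AnalyticOnNhd ℂ (fun ζ : ℂ => ζ ^ (-q) * Complex.Gamma q) {ζ : ℂ | 0 < ζ.re} :=
    DifferentiableOn.analyticOnNhd (fun z hz =>
      ((differentiableAt_id.cpow_const (Or.inl hz)).mul_const _).differentiableWithinAt)
      (isOpen_halfPlane 0)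
  refine h1.eqOn_of_preconnected_of_frequently_eq h2 (z₀ := 1)
    (convex_halfSpace_re_gt 0).isPreconnected (by simp) ?_ hζ
  have hreal : ∀ᶠ x : ℝ in 𝓝[≠] 1,
      ∫ t in Ioi (0 : ℝ), Complex.exp (-(x : ℂ) * t) * (t : ℂ) ^ (q - 1) =
        (x : ℂ) ^ (-q) * Complex.Gamma q := by
    filter_upwards [mem_nhdsWithin_of_mem_nhds (Ioi_mem_nhds (zero_lt_one' ℝ))] with x hx
    have := Complex.integral_cpow_mul_exp_neg_mul_Ioi hq (show 0 < x from hx)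
    rw [Complex.cpow_neg, ← Complex.inv_cpow, ← one_div, ← this]
    · refine setIntegral_congr_fun measurableSet_Ioi fun t _ => ?_
      simp only [neg_mul]
      exact mul_comm _ _
    · rw [Complex.arg_ofReal_of_nonneg (le_of_lt hx)]; exact Real.pi_pos.ne
  have htend : Tendsto (fun x : ℝ => (x : ℂ)) (𝓝[≠] 1) (𝓝[≠] 1) := by
    refine tendsto_nhdsWithin_iff.2 ⟨?_, ?_⟩
    · exact (Complex.continuous_ofReal.tendsto' 1 1 Complex.ofReal_one).mono_left
        nhdsWithin_le_nhds
    · filter_upwards [self_mem_nhdsWithin] with x hx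
      simpa using hx
  exact htend.frequently hreal.frequently

end Laplace

/-! ### Beta averages -/

/-- The (unnormalized) Beta average `∫₀¹ x ^ (p - 1) (1 - x) ^ (q - 1) F(t x) dx`. -/
noncomputable def betaMean (p q : ℂ) (F : ℂ → ℂ) (t : ℂ) : ℂ :=
  ∫ x in (0 : ℝ)..1, (x : ℂ) ^ (p - 1) * (1 - (x : ℂ)) ^ (q - 1) * F (t * x)

section BetaMean

variable {a R : ℝ} {F : ℂ → ℂ} {p q : ℂ}

theorem intervalIntegrable_betaMean (ha : 0 < a) (hp : 0 < p.re) (hq : 0 < q.re)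
    (hF : ContinuousOn F (region a)) {t : ℂ} (ht : t ∈ region a) :
    IntervalIntegrable (fun x : ℝ => (x : ℂ) ^ (p - 1) * (1 - (x : ℂ)) ^ (q - 1) * F (t * x))
      volume 0 1 := by
  refine (Complex.betaIntegral_convergent hp hq).mul_continuousOn ?_
  rw [uIcc_of_le zero_le_one]
  exact hF.comp (by fun_prop) fun x hx => mul_ofReal_mem_region ha ht hx

/-- Beta averages preserve `H(a, R)`: the segment `[0, t]` stays in the region of `t`, and
`exp (r |t x|) ≤ exp (r |t|)` for `r ≥ 0`. -/
theorem IsHFun.betaMean (ha : 0 < a) (hR : 0 ≤ R) (hp : 0 < p.re) (hq : 0 < q.re)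
    (hF : IsHFun a R F) : IsHFun a R (betaMean p q F) := by
  have hw := (Complex.betaIntegral_convergent hp hq).norm
  have hx1 : ∀ x ∈ uIoc (0 : ℝ) 1, x ∈ Icc (0 : ℝ) 1 := fun x hx => by
    rw [uIoc_of_le zero_le_one] at hx; exact Ioc_subset_Icc_self hx
  have hnorm : ∀ (t : ℂ) (x : ℝ), x ∈ Icc (0 : ℝ) 1 → ‖t * x‖ ≤ ‖t‖ := fun t x hx => by
    rw [norm_mul, Complex.norm_real, Real.norm_of_nonneg hx.1]
    exact mul_le_of_le_one_right (norm_nonneg t) hx.2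
  refine ⟨DifferentiableOn.analyticOnNhd (fun t₀ ht₀ => ?_) (isOpen_region a),
    fun A hA hAa r hr => ?_⟩
  · obtain ⟨A, hA, hAa, htA⟩ := exists_mem_region ha ht₀
    have hF' := hF.deriv hR
    obtain ⟨C, hC0, hC⟩ := hF'.exists_nonneg_bound hA hAa (lt_add_one R)
    have hF'c : IntervalIntegrable (fun x : ℝ =>
        (x : ℂ) ^ (p - 1) * (1 - (x : ℂ)) ^ (q - 1) * (_root_.deriv F (t₀ * x) * x)) volume 0 1 := by
      simp_rw [← mul_assoc]
      exact (intervalIntegrable_betaMean ha hp hq hF'.analytic.continuousOn ht₀).mul_continuousOn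
        (by fun_prop)
    have := intervalIntegral.hasDerivAt_integral_of_dominated_loc_of_deriv_le (μ := volume)
      (a := (0 : ℝ)) (b := 1) (x₀ := t₀) (s := region A ∩ Metric.ball t₀ 1)
      (F := fun (t : ℂ) (x : ℝ) => (x : ℂ) ^ (p - 1) * (1 - (x : ℂ)) ^ (q - 1) * F (t * x))
      (F' := fun (t : ℂ) (x : ℝ) =>
        (x : ℂ) ^ (p - 1) * (1 - (x : ℂ)) ^ (q - 1) * (_root_.deriv F (t * x) * x))
      (bound := fun x => ‖(x : ℂ) ^ (p - 1) * (1 - (x : ℂ)) ^ (q - 1)‖ *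
        (C * Real.exp ((R + 1) * (‖t₀‖ + 1))))
      (inter_mem ((isOpen_region A).mem_nhds htA) (Metric.ball_mem_nhds t₀ one_pos))
      (by
        filter_upwards [(isOpen_region a).mem_nhds ht₀] with t ht
        exact (intervalIntegrable_betaMean ha hp hq hF.analytic.continuousOn
          ht).def'.aestronglyMeasurable)
      (intervalIntegrable_betaMean ha hp hq hF.analytic.continuousOn ht₀)
      hF'c.def'.aestronglyMeasurable
      (ae_of_all _ fun x hx t ht => by
        have hx' := hx1 x hx
        rw [norm_mul]
        refine mul_le_mul_of_nonneg_left ?_ (norm_nonneg _)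
        have h1 : ‖t‖ ≤ ‖t₀‖ + 1 := by
          have := norm_le_norm_sub_add t t₀
          have := mem_ball_iff_norm.1 ht.2
          linarith
        calc ‖_root_.deriv F (t * x) * x‖ ≤ ‖_root_.deriv F (t * x)‖ := by
              rw [norm_mul, Complex.norm_real, Real.norm_of_nonneg hx'.1]
              exact mul_le_of_le_one_right (norm_nonneg _) hx'.2
          _ ≤ C * Real.exp ((R + 1) * ‖t * x‖) := hC _ (mul_ofReal_mem_region hA ht.1 hx')
          _ ≤ C * Real.exp ((R + 1) * (‖t₀‖ + 1)) := by
              gcongr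
              exact (hnorm t x hx').trans h1)
      (hw.mul_const _)
      (ae_of_all _ fun x hx t ht => by
        have h1 : HasDerivAt (fun t : ℂ => t * (x : ℂ)) x t := by
          simpa using (hasDerivAt_id t).mul_const (x : ℂ)
        have h2 : HasDerivAt F (_root_.deriv F (t * x)) (t * x) :=
          (hF.analytic _ (mul_ofReal_mem_region ha (region_mono hAa.le ht.1)
            (hx1 x hx))).differentiableAt.hasDerivAt
        exact (h2.comp t h1).const_mul _)
    exact this.2.differentiableAt.differentiableWithinAt
  · obtain ⟨C, hC0, hC⟩ := hF.exists_nonneg_bound hA hAa hr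
    refine ⟨(∫ x in (0 : ℝ)..1, ‖(x : ℂ) ^ (p - 1) * (1 - (x : ℂ)) ^ (q - 1)‖) * C,
      fun t ht => ?_⟩
    rw [mul_assoc, ← intervalIntegral.integral_mul_const]
    refine intervalIntegral.norm_integral_le_of_norm_le zero_le_one
      (ae_of_all _ fun x hx => ?_) (hw.mul_const _)
    have hx' := Ioc_subset_Icc_self hx
    have hr0 : 0 ≤ r := hR.trans hr.le
    rw [norm_mul]
    refine mul_le_mul_of_nonneg_left ((hC _ (mul_ofReal_mem_region hA ht hx')).trans ?_)
      (norm_nonneg _)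
    gcongr
    exact hnorm t x hx'

/-- For `t > 0` a Beta average is, up to a power of `t`, a Riemann-Liouville integral. -/
theorem cpow_mul_betaMean {t : ℝ} (ht : 0 < t) :
    (t : ℂ) ^ (p + q - 1) * betaMean p q F t =
      ∫ s in (0 : ℝ)..t, (s : ℂ) ^ (p - 1) * ((t - s : ℝ) : ℂ) ^ (q - 1) * F s := by
  have ht0 : (t : ℂ) ≠ 0 := Complex.ofReal_ne_zero.2 ht.ne'
  have h := intervalIntegral.smul_integral_comp_mul_left (a := 0) (b := 1)
    (fun s : ℝ => (s : ℂ) ^ (p - 1) * ((t - s : ℝ) : ℂ) ^ (q - 1) * F s) t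
  rw [mul_zero, mul_one] at h
  rw [← h, LaplaceBorel.betaMean, Complex.real_smul, ← intervalIntegral.integral_const_mul,
    ← intervalIntegral.integral_const_mul]
  refine intervalIntegral.integral_congr fun x hx => ?_
  rw [uIcc_of_le zero_le_one] at hx
  have h1 : t - t * x = t * (1 - x) := by ring
  have h2 : p + q - 1 = 1 + (p - 1) + (q - 1) := by ring
  simp only [h1]
  rw [Complex.ofReal_mul, Complex.ofReal_mul, Complex.mul_cpow_ofReal_nonneg ht.le hx.1,
    Complex.mul_cpow_ofReal_nonneg ht.le (sub_nonneg.2 hx.2), h2, Complex.cpow_add _ _ ht0,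
    Complex.cpow_add _ _ ht0, Complex.cpow_one, Complex.ofReal_sub, Complex.ofReal_one]
  ring

/-- The convolution theorem, for the convolution of `t ^ (p - 1) F(t)` with `t ^ (q - 1)`. -/
theorem integral_cpow_mul_betaMean (ha : 0 < a) (hR : 0 ≤ R) (hp : 0 < p.re) (hq : 0 < q.re)
    (hF : IsHFun a R F) {ζ : ℂ} (hζ : R < ζ.re) :
    ∫ t in Ioi (0 : ℝ), Complex.exp (-ζ * t) * ((t : ℂ) ^ (p + q - 1) * betaMean p q F t) =
      ζ ^ (-q) * Complex.Gamma q *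
        ∫ t in Ioi (0 : ℝ), Complex.exp (-ζ * t) * ((t : ℂ) ^ (p - 1) * F t) := by
  have hp1 : -1 < (p - 1).re := by rw [Complex.sub_re, Complex.one_re]; linarith
  have hq1 : -1 < (q - 1).re := by rw [Complex.sub_re, Complex.one_re]; linarith
  have h1 := integrableOn_laplace_integrand ha hF hp1 hζ
  have h2 := integrableOn_laplace_integrand one_pos isHFun_one hq1 (hR.trans_lt hζ)
  simp only [mul_one] at h2
  have h3 := integral_posConvolution h1 h2 (ContinuousLinearMap.mul ℝ ℂ)
  simp only [ContinuousLinearMap.mul_apply'] at h3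
  rw [integral_exp_mul_cpow hq (hR.trans_lt hζ), mul_comm] at h3
  rw [← h3]
  refine setIntegral_congr_fun measurableSet_Ioi fun t ht => ?_
  rw [cpow_mul_betaMean ht, ← intervalIntegral.integral_const_mul]
  refine intervalIntegral.integral_congr fun s _ => ?_
  have : Complex.exp (-ζ * t) = Complex.exp (-ζ * s) * Complex.exp (-ζ * (t - s : ℝ)) := by
    rw [← Complex.exp_add]; push_cast; ring_nf
  simp only [this]
  ring

end BetaMean

/-! ### The image of `H(a, R)` under `𝓛_α` -/

theorem mem_halfPlaneFilter (R : ℝ) : {ζ : ℂ | R < ζ.re} ∈ halfPlaneFilter :=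
  preimage_mem_comap (Ioi_mem_atTop R)

theorem mem_regionFilter {a : ℝ} (ha : 0 < a) : region a ∈ regionFilter :=
  mem_iInf_of_mem a (mem_iInf_of_mem ha (mem_principal_self _))

theorem laplaceα_zero : laplaceα 0 = laplace := by
  funext φ
  induction φ using Germ.inductionOn with
  | _ F =>
    simp only [laplaceα, laplace, Germ.liftOn, Complex.cpow_zero, one_mul]

theorem laplaceα_coe (α : ℂ) (F : ℂ → ℂ) : laplaceα α (F : TFun) =
    ((fun ζ => ζ ^ α * laplaceIntegral (fun t => (t : ℂ) ^ α * F t) ζ : ℂ → ℂ) : ZFun) := rfl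

section Image

variable {a R : ℝ}

theorem image_laplaceα_add_one_subset (ha : 0 < a) (hR : 0 ≤ R) {α : ℂ} (hα : -1 < α.re) :
    laplaceα (α + 1) '' Hspace a R ⊆ laplaceα α '' Hspace a R := by
  rintro _ ⟨_, ⟨F, hF, rfl⟩, rfl⟩
  refine ⟨_, ⟨_, (hF.const_mul (α + 1)).add (hF.deriv hR).id_mul, rfl⟩, ?_⟩
  rw [laplaceα_coe, laplaceα_coe, Germ.coe_eq]
  filter_upwards [mem_halfPlaneFilter R] with ζ hζ
  have hζ0 : ζ ≠ 0 := by
    rintro rfl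
    exact absurd hζ (not_lt.2 hR)
  rw [laplaceIntegral, laplaceIntegral, ← mul_integral_cpow_add_one ha hR hF hα hζ,
    Complex.cpow_add _ _ hζ0, Complex.cpow_one]
  ring

theorem image_laplaceα_subset_of_re_lt (ha : 0 < a) (hR : 0 ≤ R) {β γ : ℂ} (hβ : -1 < β.re)
    (hβγ : β.re < γ.re) : laplaceα β '' Hspace a R ⊆ laplaceα γ '' Hspace a R := by
  rintro _ ⟨_, ⟨F, hF, rfl⟩, rfl⟩
  have hp : 0 < (β + 1).re := by rw [Complex.add_re, Complex.one_re]; linarith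
  have hq : 0 < (γ - β).re := by rw [Complex.sub_re]; linarith
  have hΓ : Complex.Gamma (γ - β) ≠ 0 := Complex.Gamma_ne_zero_of_re_pos hq
  refine ⟨_, ⟨_, (hF.betaMean ha hR hp hq).const_mul (Complex.Gamma (γ - β))⁻¹, rfl⟩, ?_⟩
  rw [laplaceα_coe, laplaceα_coe, Germ.coe_eq]
  filter_upwards [mem_halfPlaneFilter R] with ζ hζ
  have hζ0 : ζ ≠ 0 := by
    rintro rfl
    exact absurd hζ (not_lt.2 hR)
  have key := integral_cpow_mul_betaMean ha hR hp hq hF hζ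
  rw [show β + 1 + (γ - β) - 1 = γ by ring, show β + 1 - 1 = β by ring] at key
  have hpull : ∀ t : ℝ, Complex.exp (-ζ * t) * ((t : ℂ) ^ γ *
        ((Complex.Gamma (γ - β))⁻¹ * betaMean (β + 1) (γ - β) F t)) =
      (Complex.Gamma (γ - β))⁻¹ *
        (Complex.exp (-ζ * t) * ((t : ℂ) ^ γ * betaMean (β + 1) (γ - β) F t)) :=
    fun t => by ring
  simp only [laplaceIntegral, hpull, integral_const_mul]
  rw [key, show -(γ - β) = β - γ by ring, Complex.cpow_sub _ _ hζ0]
  have hζγ : ζ ^ γ ≠ 0 := by simp [Complex.cpow_eq_zero_iff, hζ0]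
  field_simp

theorem image_laplaceα_add_natCast_subset (ha : 0 < a) (hR : 0 ≤ R) {α : ℂ} (hα : -1 < α.re)
    (n : ℕ) : laplaceα (α + n) '' Hspace a R ⊆ laplaceα α '' Hspace a R := by
  induction n with
  | zero => simp
  | succ n ih =>
    have hn : -1 < (α + n).re := by
      rw [Complex.add_re, Complex.natCast_re]
      have := Nat.cast_nonneg (α := ℝ) n
      linarith
    have := (image_laplaceα_add_one_subset ha hR hn).trans ih
    rwa [add_assoc, ← Nat.cast_succ] at this

/-- Raising the parameter far enough by a Beta average and lowering it again by integration by
parts connects any two parameters. -/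
theorem image_laplaceα_subset (ha : 0 < a) (hR : 0 ≤ R) {β γ : ℂ} (hβ : -1 < β.re)
    (hγ : -1 < γ.re) : laplaceα β '' Hspace a R ⊆ laplaceα γ '' Hspace a R := by
  obtain ⟨n, hn⟩ := exists_nat_gt (β.re - γ.re)
  refine (image_laplaceα_subset_of_re_lt ha hR hβ (γ := γ + n) ?_).trans
    (image_laplaceα_add_natCast_subset ha hR hγ n)
  rw [Complex.add_re, Complex.natCast_re]
  linarith

theorem image_laplaceα (ha : 0 < a) (hR : 0 ≤ R) {α : ℂ} (hα : -1 < α.re) :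
    laplaceα α '' Hspace a R = Sspace a R := by
  have h0 : -1 < (0 : ℂ).re := by simp
  rw [Sspace, ← laplaceα_zero]
  exact (image_laplaceα_subset ha hR hα h0).antisymm (image_laplaceα_subset ha hR h0 hα)

theorem Hspace_subset_Hunion (ha : 0 < a) (hR : 0 ≤ R) : Hspace a R ⊆ Hunion :=
  fun _ h => ⟨a, R, ha, hR, h⟩

end Image

theorem image_laplaceα_Hunion {α : ℂ} (hα : -1 < α.re) : laplaceα α '' Hunion = Sunion := by
  refine Subset.antisymm ?_ ?_
  · rintro _ ⟨φ, ⟨a, R, ha, hR, hφ⟩, rfl⟩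
    exact image_mono (Hspace_subset_Hunion ha hR)
      ((image_laplaceα ha hR hα).subset (mem_image_of_mem _ hφ))
  · rintro _ ⟨φ, ⟨a, R, ha, hR, hφ⟩, rfl⟩
    exact image_mono (Hspace_subset_Hunion ha hR)
      ((image_laplaceα ha hR hα).superset (mem_image_of_mem _ hφ))

/-! ### Injectivity of `𝓛_α` -/

/-- A function whose Laplace transform vanishes on a vertical line is zero: on that line the
Laplace transform is a Fourier transform. -/
theorem eq_zero_of_laplace_eq_zero {f : ℝ → ℂ} {σ : ℝ} (hc : ContinuousOn f (Ioi 0))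
    (hint : IntegrableOn (fun t : ℝ => Complex.exp (-(σ : ℂ) * t) * f t) (Ioi 0))
    (h : ∀ ζ : ℂ, ζ.re = σ → ∫ t in Ioi (0 : ℝ), Complex.exp (-ζ * t) * f t = 0)
    {t : ℝ} (ht : 0 < t) : f t = 0 := by
  set g : ℝ → ℂ := indicator (Ioi 0) (fun t => Complex.exp (-(σ : ℂ) * t) * f t) with hg
  have hgi : Integrable g := (integrable_indicator_iff measurableSet_Ioi).2 hint
  have hF : FourierTransform.fourier g = fun _ : ℝ => (0 : ℂ) := by
    funext w
    rw [Real.fourier_real_eq_integral_exp_smul]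
    rw [← h (σ + 2 * Real.pi * w * Complex.I) (by simp), ← integral_indicator measurableSet_Ioi]
    congr 1
    funext s
    by_cases hs : s ∈ Ioi (0 : ℝ)
    · simp only [hg, indicator_of_mem hs, smul_eq_mul]
      rw [← mul_assoc, ← Complex.exp_add]
      congr 2
      push_cast
      ring
    · simp [hg, indicator_of_notMem hs]
  have hgc : ContinuousAt g t := by
    have h1 : ContinuousAt (fun t : ℝ => Complex.exp (-(σ : ℂ) * t) * f t) t :=
      ContinuousAt.mul (by fun_prop) (hc.continuousAt (Ioi_mem_nhds ht))
    refine h1.congr ?_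
    filter_upwards [Ioi_mem_nhds ht] with s hs
    rw [hg, indicator_of_mem hs]
  have hinv := hgi.fourierInv_fourier_eq (by rw [hF]; exact integrable_zero _ _ _) hgc
  rw [hF, Real.fourierInv_eq] at hinv
  simpa [hg, ht, Complex.exp_ne_zero] using hinv.symm

theorem IsHFun.eqOn_zero {a R : ℝ} (ha : 0 < a) {F : ℂ → ℂ} (hF : IsHFun a R F)
    (h : ∀ t : ℝ, 0 < t → F t = 0) : EqOn F 0 (region a) := by
  refine hF.analytic.eqOn_of_preconnected_of_frequently_eq (fun _ _ => analyticAt_const)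
    (convex_region a).isPreconnected (z₀ := ((1 : ℝ) : ℂ)) (ofReal_mem_region ha zero_le_one) ?_
  have htend : Tendsto (fun x : ℝ => (x : ℂ)) (𝓝[≠] 1) (𝓝[≠] ((1 : ℝ) : ℂ)) := by
    refine tendsto_nhdsWithin_iff.2 ⟨?_, ?_⟩
    · exact (Complex.continuous_ofReal.tendsto 1).mono_left nhdsWithin_le_nhds
    · filter_upwards [self_mem_nhdsWithin] with x hx
      exact fun h => hx (Complex.ofReal_injective h)
  refine htend.frequently (Eventually.frequently ?_)
  filter_upwards [mem_nhdsWithin_of_mem_nhds (Ioi_mem_nhds (zero_lt_one' ℝ))] with x hx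
  exact h x hx

theorem injOn_laplaceα {α : ℂ} (hα : -1 < α.re) : InjOn (laplaceα α) Hunion := by
  rintro _ ⟨a₁, R₁, ha₁, hR₁, F, hF, rfl⟩ _ ⟨a₂, R₂, ha₂, hR₂, G, hG, rfl⟩ h
  have ha : 0 < min a₁ a₂ := lt_min ha₁ ha₂
  replace hF := hF.mono (min_le_left a₁ a₂) (le_max_left R₁ R₂)
  replace hG := hG.mono (min_le_right a₁ a₂) (le_max_right R₁ R₂)
  have hD := hF.sub hG
  rw [laplaceα_coe, laplaceα_coe, Germ.coe_eq] at h
  obtain ⟨s, hs, hs'⟩ := mem_comap.1 h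
  obtain ⟨σ₀, hσ₀⟩ := mem_atTop_sets.1 hs
  obtain ⟨σ, hσ⟩ := exists_gt (max σ₀ (max R₁ R₂))
  obtain ⟨hσσ, hσR⟩ := max_lt_iff.1 hσ
  have hσ0 : 0 < σ := (hR₁.trans (le_max_left _ _)).trans_lt hσR
  have hvan : ∀ ζ : ℂ, ζ.re = σ →
      ∫ t in Ioi (0 : ℝ), Complex.exp (-ζ * t) * ((t : ℂ) ^ α * (F t - G t)) = 0 := by
    intro ζ hζ
    have hζ0 : ζ ≠ 0 := by
      rintro rfl
      exact hσ0.ne hζ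
    have hζα : ζ ^ α ≠ 0 := by simp [Complex.cpow_eq_zero_iff, hζ0]
    have hζR : max R₁ R₂ < ζ.re := hζ ▸ hσR
    have heq : ζ ^ α * laplaceIntegral (fun t => (t : ℂ) ^ α * F t) ζ =
        ζ ^ α * laplaceIntegral (fun t => (t : ℂ) ^ α * G t) ζ :=
      hs' (show ζ.re ∈ s from hσ₀ _ (hζ ▸ hσσ.le))
    have heq' := mul_left_cancel₀ hζ0 (mul_left_cancel₀ hζα heq)
    simp only [mul_sub]
    rw [integral_sub (integrableOn_laplace_integrand ha hF hα hζR)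
      (integrableOn_laplace_integrand ha hG hα hζR), heq', sub_self]
  have hσR' : max R₁ R₂ < (σ : ℂ).re := hσR
  have hzero : ∀ t : ℝ, 0 < t → F t - G t = 0 := by
    intro t ht
    have hc : ContinuousOn (fun t : ℝ => (t : ℂ) ^ α * (F t - G t)) (Ioi 0) := by
      simpa using continuousOn_laplace_integrand ha hD α 0
    have := eq_zero_of_laplace_eq_zero hc (integrableOn_laplace_integrand ha hD hα hσR') hvan ht
    refine (mul_eq_zero.1 this).resolve_left ?_
    simp [Complex.cpow_eq_zero_iff, ht.ne']
  rw [Germ.coe_eq]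
  filter_upwards [mem_regionFilter ha] with t ht
  exact sub_eq_zero.1 (hD.eqOn_zero ha hzero ht)

theorem bijOn_invFunOn {X Y : Type*} [Nonempty X] {f : X → Y} {U V : Set X} {W : Set Y}
    (hf : InjOn f U) (hVU : V ⊆ U) (hW : f '' V = W) : BijOn (Function.invFunOn f U) W V := by
  subst hW
  have h : LeftInvOn (Function.invFunOn f U) f V := hf.leftInvOn_invFunOn.mono hVU
  exact BijOn.symm ⟨h.rightInvOn_image, h⟩ (hf.mono hVU).bijOn_image

end LaplaceBorel

/-- The first two conjuncts say that the inverses used to define the four operators exist on the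
spaces in question; the rest is the bijectivity of the operators. -/
theorem theorem2 (α : ℂ) (hα : -1 < α.re) :
    (Set.BijOn LaplaceBorel.laplace LaplaceBorel.Hunion LaplaceBorel.Sunion ∧
      Set.BijOn (LaplaceBorel.laplaceα α) LaplaceBorel.Hunion LaplaceBorel.Sunion) ∧
    (∀ a R : ℝ, 0 < a → 0 ≤ R →
      (∀ φ ∈ LaplaceBorel.Hspace a R,
        LaplaceBorel.fracD α φ ∈ LaplaceBorel.Hspace a R ∧
        LaplaceBorel.fracI α φ ∈ LaplaceBorel.Hspace a R) ∧
      Set.BijOn (LaplaceBorel.fracD α) (LaplaceBorel.Hspace a R) (LaplaceBorel.Hspace a R) ∧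
      Set.BijOn (LaplaceBorel.fracI α) (LaplaceBorel.Hspace a R) (LaplaceBorel.Hspace a R) ∧
      Set.BijOn (LaplaceBorel.dualD α) (LaplaceBorel.Sspace a R) (LaplaceBorel.Sspace a R) ∧
      Set.BijOn (LaplaceBorel.dualI α) (LaplaceBorel.Sspace a R) (LaplaceBorel.Sspace a R)) ∧
    Set.BijOn (LaplaceBorel.fracD α) LaplaceBorel.Hunion LaplaceBorel.Hunion ∧
    Set.BijOn (LaplaceBorel.fracI α) LaplaceBorel.Hunion LaplaceBorel.Hunion ∧
    Set.BijOn (LaplaceBorel.dualD α) LaplaceBorel.Sunion LaplaceBorel.Sunion ∧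
    Set.BijOn (LaplaceBorel.dualI α) LaplaceBorel.Sunion LaplaceBorel.Sunion := by
  open LaplaceBorel in
  have hiα : InjOn (laplaceα α) Hunion := injOn_laplaceα hα
  have hi : InjOn laplace Hunion := laplaceα_zero ▸ injOn_laplaceα (α := 0) (by simp)
  -- The four conclusions for a subspace `V` of `H` whose images under both transforms agree.
  have key : ∀ (V : Set TFun) (W : Set ZFun), V ⊆ Hunion → laplace '' V = W →
      laplaceα α '' V = W →
      BijOn (fracD α) V V ∧ BijOn (fracI α) V V ∧ BijOn (dualD α) W W ∧ BijOn (dualI α) W W := by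
    intro V W hV hW hWα
    have h1 : BijOn laplace V W := hW ▸ (hi.mono hV).bijOn_image
    have h2 : BijOn (laplaceα α) V W := hWα ▸ (hiα.mono hV).bijOn_image
    have h3 : BijOn laplaceInv W V := bijOn_invFunOn hi hV hW
    have h4 : BijOn (laplaceαInv α) W V := bijOn_invFunOn hiα hV hWα
    exact ⟨h3.comp h2, h4.comp h1, h2.comp h3, h1.comp h4⟩
  have hU := image_laplaceα_Hunion hα
  refine ⟨⟨hi.bijOn_image, hU ▸ hiα.bijOn_image⟩, fun a R ha hR => ?_,
    key Hunion Sunion Subset.rfl rfl hU⟩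
  have h := key (Hspace a R) (Sspace a R) (Hspace_subset_Hunion ha hR) rfl
    (image_laplaceα ha hR hα)
  exact ⟨fun φ hφ => ⟨h.1.mapsTo hφ, h.2.1.mapsTo hφ⟩, h⟩
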